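/- Let $n\ge 0$ be an integer, let $K\subseteq[0,1]^n$ be compact and let $f:K\to[0,1]$ be a function. Then $f$ is implementable by a Bernoulli factory on $K$ if and only if $f$ is continuous and both $f$ and $1-f$ are polynomially bounded on $K$. Here a Bernoulli factory is a (possibly infinite) rooted binary tree in which every node has either two children or none; each internal node is labelled with an index $i\in\{1,\dots,n\}$ or with a constant $c\in(0,1)$, and each leaf is labelled $0$ or $1$. Run with $p=(p_1,\dots,p_n)\in[0,1]^n$, it starts at the root and at each internal node independently flips a coin of bias $p_i$ (label $i$) or of bias $c$ (label $c$), moving along the right edge on outcome $1$ and along the left edge on outcome $0$; upon reaching a leaf it outputs the label of that leaf. The function $f$ is implementable by a Bernoulli factory on $K$ if there is a single such tree that, for every $p\in K$, reaches a leaf almost surely and outputs $1$ with probability $f(p)$. For a partition $\{1,\dots,n\}=A\sqcup S\sqcup B$ (parts may be empty) let $F_{A,S,B}$ be the set of $p\in[0,1]^n$ with $p_i=0$ for $i\in A$, $0<p_i<1$ for $i\in S$ and $p_i=1$ for $i\in B$. A function $g:K\to[0,1]$ is polynomially bounded on $K$ if there are an integer $m\ge 0$ and a real $c>0$ such that for every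 such partition $(A,S,B)$: if $g(q)>0$ for some $q\in K\cap F_{A,S,B}$, then $$g(p)\ \ge\ c\Big(\prod_{i\in A}(1-p_i)\ \prod_{i\in S}p_i(1-p_i)\ \prod_{i\in B}p_i\Big)^m\qquad\text{for all }p\in K.$$ -/

import Mathlib

/-- Label of a node of a factory tree with `n` input coins: an internal node flips either the
input coin `i` or a helper coin of known bias `c ∈ (0,1)`; a leaf carries the output bit
(`true` is `1`, `false` is `0`). -/
inductive FactoryLabel (n : ℕ) : Type
  | coin (i : Fin n) : FactoryLabel n
  | const (c : Set.Ioo (0 : ℝ) 1) : FactoryLabel n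
  | leaf (b : Bool) : FactoryLabel n

/-- A Bernoulli factory with `n` input coins: a (possibly infinite) rooted binary tree with
labelled nodes. A node is addressed by the word of edges (`false` = left = `0`,
`true` = right = `1`) leading to it from the root `[]`, the edge at the root being the first
letter. A node labelled `leaf` has no children and every other node has two children, so the nodes
of the tree are the words none of whose proper prefixes is labelled `leaf`. The labels of
the other words play no role: such words are reached with probability `0` below. -/
structure BernoulliFactory (n : ℕ) : Type where
  /-- the label of the node with the given address -/
  label : List Bool → FactoryLabel n

/-- The probability that, at a node with the given label, the execution with input biases `p`
continues along the edge `b`. There are no edges out of a leaf. -/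
noncomputable def FactoryLabel.edgeProb {n : ℕ} (p : Fin n → ℝ) :
    FactoryLabel n → Bool → ENNReal
  | .coin i, true => ENNReal.ofReal (p i)
  | .coin i, false => ENNReal.ofReal (1 - p i)
  | .const c, true => ENNReal.ofReal (c : ℝ)
  | .const c, false => ENNReal.ofReal (1 - (c : ℝ))
  | .leaf _, _ => 0

namespace BernoulliFactory

/-- The subtree rooted at the child of the root along the edge `b`. -/
def subtree {n : ℕ} (F : BernoulliFactory n) (b : Bool) : BernoulliFactory n :=
  ⟨fun w => F.label (b :: w)⟩

/-- The probability that the execution of `F` with input biases `p` visits the node with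
address `w`: the flips are independent, so this is the product of the probabilities of the edges
on the path from the root to `w`. -/
noncomputable def reachProb {n : ℕ} (F : BernoulliFactory n) (p : Fin n → ℝ) :
    List Bool → ENNReal
  | [] => 1
  | b :: w => (F.label []).edgeProb p b * reachProb (F.subtree b) p w

/-- The probability that the execution of `F` with input biases `p` reaches a leaf labelled `b`
(after finitely many flips). At most one leaf is reached, so this is the sum over these leaves. -/
noncomputable def outputProb {n : ℕ} (F : BernoulliFactory n) (p : Fin n → ℝ) (b : Bool) :
    ENNReal :=
  ∑' w : {w : List Bool // F.label w = FactoryLabel.leaf b}, F.reachProb p w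

/-- With input biases `p`, the execution of `F` reaches a leaf with probability one. -/
def TerminatesAlmostSurely {n : ℕ} (F : BernoulliFactory n) (p : Fin n → ℝ) : Prop :=
  F.outputProb p false + F.outputProb p true = 1

end BernoulliFactory

/-- `f` is implementable by a Bernoulli factory on `K`: some factory terminates almost surely
for every vector of biases `p ∈ K` and then outputs `1` with probability `f p`. -/
def ImplementableByFactory {n : ℕ} (K : Set (Fin n → ℝ)) (f : K → ℝ) : Prop :=
  ∃ F : BernoulliFactory n, ∀ p : K,
    F.TerminatesAlmostSurely (p : Fin n → ℝ) ∧
      F.outputProb (p : Fin n → ℝ) true = ENNReal.ofReal (f p)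

/-- `A`, `S`, `B` partition the index set (parts may be empty). -/
def IsFacePartition {n : ℕ} (A S B : Finset (Fin n)) : Prop :=
  Disjoint A S ∧ Disjoint A B ∧ Disjoint S B ∧ A ∪ S ∪ B = Finset.univ

/-- The open face `F_{A,S,B}` of the hypercube `[0,1]^n`. -/
def openFace {n : ℕ} (A S B : Finset (Fin n)) : Set (Fin n → ℝ) :=
  {p | p ∈ Set.Icc (0 : Fin n → ℝ) 1 ∧
    (∀ i ∈ A, p i = 0) ∧ (∀ i ∈ S, 0 < p i ∧ p i < 1) ∧ (∀ i ∈ B, p i = 1)}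

/-- `f : K → ℝ` is polynomially bounded on `K`. -/
def PolynomiallyBounded {n : ℕ} (K : Set (Fin n → ℝ)) (f : K → ℝ) : Prop :=
  ∃ (m : ℕ) (c : ℝ), 0 < c ∧
    ∀ A S B : Finset (Fin n), IsFacePartition A S B →
      (∃ q : K, (q : Fin n → ℝ) ∈ openFace A S B ∧ 0 < f q) →
        ∀ p : K,
          c * ((∏ i ∈ A, (1 - (p : Fin n → ℝ) i)) * (∏ i ∈ S, (p : Fin n → ℝ) i) *
            (∏ i ∈ S, (1 - (p : Fin n → ℝ) i)) * (∏ i ∈ B, (p : Fin n → ℝ) i)) ^ m ≤ f p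

/-!
# Functions implementable by Bernoulli factories

*Necessity.* The probability that a given node is reached is a product of factors `p i`, `1 - p i`
and constants, so it is continuous in `p`. As sums of such probabilities, the output probabilities
`f` and `1 - f` are lower semicontinuous, which makes `f` continuous (`Realizable.continuous`). If
`f q > 0` for a point `q` of an open face, then a leaf labelled `1` is reached with positive
probability at `q`. No factor on the path to this leaf vanishes on that open face, so each of them
is at least a constant times the monomial of the face on the whole cube. This one leaf gives the
polynomial bound (`polynomiallyBounded_of_outputProb`).

*Sufficiency.* All factories are obtained by one construction, the sequential composition
`Realizable.chain`: run selectors until one of them outputs `1`, then run the factory attached to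
it. The output probabilities of the composition need to be estimated from below only, because they
add up to at most one (`BernoulliFactory.Simulates.of_le`). Special cases are mixtures, products,
the race of two coins and infinite geometric mixtures.

Let `f` satisfy the analytic conditions. It suffices to write `f = g / 8 + 7 f' / 8` with `g`
implementable and `f'` subject to the same conditions (`Admissible.exists_mix`): iterating this
expresses `f` as an infinite geometric mixture of implementable functions
(`Admissible.realizable`). If `g ≤ f` where `f ≤ 1 / 4`, and `1 - g ≤ 1 - f` where `f ≥ 3 / 4`, then
`f' ≥ f / 2` and `1 - f' ≥ (1 - f) / 2`, so that `f'` inherits the polynomial bounds.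

Such a `g` is constructed in `exists_realizable_approx`. By the polynomial bounds, there are
implementable `u ≤ f` and `v ≤ 1 - f` with the same zeros as `f` and `1 - f`
(`PolynomiallyBounded.exists_realizable_le`). By the Stone-Weierstrass theorem, applied to the
algebra of all `φ` such that `1 / 2 + a * φ` is implementable for some `a > 0`, there is an
implementable `x` which is less than `1 / 2` where `f ≤ 1 / 4` and greater than `1 / 2` where
`f ≥ 3 / 4`, by a uniform margin (`exists_realizable_separating`). The function `g` is the
probability that the coin `u * x ^ r` wins a race against the coin `v * (1 - x) ^ r`, for a large
exponent `r`. One of the two coins has positive bias, as `f` and `1 - f` have no common zero. Where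
`f ≤ 1 / 4`, compactness bounds `v` away from zero, and then `g ≤ x ^ r / (v * (1 - x) ^ r) * u` is
at most `u`, and symmetrically where `f ≥ 3 / 4`.
-/

/-! ### Output probabilities -/

/-- The tree `F` with input biases `p` outputs `1` with probability `x` and `0` with
probability `1 - x`. -/
def BernoulliFactory.Simulates {n : ℕ} (F : BernoulliFactory n) (p : Fin n → ℝ) (x : ℝ) : Prop :=
  F.outputProb p true = ENNReal.ofReal x ∧ F.outputProb p false = ENNReal.ofReal (1 - x)

theorem ENNReal.tsum_list_eq {α : Type*} [Fintype α] (g : List α → ENNReal) :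
    ∑' w, g w = g [] + ∑ a, ∑' w, g (a :: w) := by
  let e : Option (α × List α) ≃ List α :=
    { toFun := fun o => o.elim [] (fun q => q.1 :: q.2)
      invFun := fun w => match w with
        | [] => none
        | a :: w => some (a, w)
      left_inv := by rintro (_ | ⟨a, w⟩) <;> rfl
      right_inv := by rintro (_ | ⟨a, w⟩) <;> rfl }
  rw [← e.tsum_eq, ENNReal.tsum_eq_add_tsum_ite none,
    ← (Function.Injective.tsum_eq (Option.some_injective (α × List α)) _), ENNReal.tsum_prod',
    tsum_fintype]
  · simp [e]
  · rintro (_ | q)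
    · simp
    · simp

namespace BernoulliFactory

open scoped Classical in
/-- The probability that `F` outputs `b` after fewer than `d` flips. -/
noncomputable def outputWithin {n : ℕ} (F : BernoulliFactory n) (p : Fin n → ℝ) (b : Bool)
    (d : ℕ) : ENNReal :=
  ∑' w : List Bool, if F.label w = FactoryLabel.leaf b ∧ w.length < d then F.reachProb p w else 0

variable {n : ℕ} (F : BernoulliFactory n) (p : Fin n → ℝ) (b : Bool)

open scoped Classical in
theorem outputProb_eq_tsum_ite :
    F.outputProb p b =
      ∑' w : List Bool, if F.label w = FactoryLabel.leaf b then F.reachProb p w else 0 := by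
  rw [outputProb, ← tsum_subtype_eq_of_support_subset (s := {w | F.label w = .leaf b})]
  · exact tsum_congr fun w => (if_pos w.2).symm
  · intro w hw
    by_contra h
    exact hw (if_neg h)

open scoped Classical in
theorem outputProb_eq :
    F.outputProb p b = (if F.label [] = FactoryLabel.leaf b then 1 else 0) +
      ∑ e, (F.label []).edgeProb p e * (F.subtree e).outputProb p b := by
  simp only [outputProb_eq_tsum_ite]
  rw [ENNReal.tsum_list_eq]
  simp only [← ENNReal.tsum_mul_left, mul_ite, mul_zero]
  rfl

@[simp] theorem outputWithin_zero : F.outputWithin p b 0 = 0 := by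
  simp [outputWithin]

open scoped Classical in
theorem outputWithin_succ (d : ℕ) :
    F.outputWithin p b (d + 1) = (if F.label [] = FactoryLabel.leaf b then 1 else 0) +
      ∑ e, (F.label []).edgeProb p e * (F.subtree e).outputWithin p b d := by
  simp only [outputWithin]
  rw [ENNReal.tsum_list_eq]
  simp only [← ENNReal.tsum_mul_left, mul_ite, mul_zero, List.length_cons, List.length_nil,
    Nat.zero_lt_succ, and_true, Nat.add_lt_add_iff_right]
  rfl

theorem tendsto_outputWithin :
    Filter.Tendsto (F.outputWithin p b) Filter.atTop (nhds (F.outputProb p b)) := by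
  classical
  have hmono : Monotone (F.outputWithin p b) := by
    intro d e hde
    refine ENNReal.tsum_le_tsum fun w => ?_
    split_ifs with h1 h2
    · exact le_rfl
    · exact absurd ⟨h1.1, h1.2.trans_le hde⟩ h2
    · exact zero_le
    · exact le_rfl
  have hsup : F.outputProb p b = ⨆ d, F.outputWithin p b d := by
    refine le_antisymm ?_ (iSup_le fun d => ?_)
    · rw [outputProb_eq_tsum_ite, ENNReal.tsum_eq_iSup_sum]
      refine iSup_le fun s => le_iSup_of_le (s.sup List.length + 1) ?_
      refine le_trans (Finset.sum_le_sum fun w hw => ?_) (ENNReal.sum_le_tsum s)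
      have : w.length < s.sup List.length + 1 :=
        Nat.lt_succ_of_le (Finset.le_sup (f := List.length) hw)
      simp [this]
    · rw [outputProb_eq_tsum_ite]
      refine ENNReal.tsum_le_tsum fun w => ?_
      split_ifs with h1 h2
      · exact le_rfl
      · exact absurd h1.1 h2
      · exact zero_le
      · exact le_rfl
  rw [hsup]
  exact tendsto_atTop_iSup hmono

variable {p}

theorem outputWithin_add_le_one (hp : p ∈ Set.Icc (0 : Fin n → ℝ) 1) (d : ℕ) :
    F.outputWithin p true d + F.outputWithin p false d ≤ 1 := by
  induction d generalizing F with
  | zero => simp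
  | succ d ih =>
    have key : ∀ x y : ENNReal, x + y ≤ 1 →
        x * (F.subtree true).outputWithin p true d + y * (F.subtree false).outputWithin p true d +
        (x * (F.subtree true).outputWithin p false d +
          y * (F.subtree false).outputWithin p false d) ≤ 1 := by
      intro x y hxy
      calc _ = x * ((F.subtree true).outputWithin p true d +
              (F.subtree true).outputWithin p false d) +
            y * ((F.subtree false).outputWithin p true d +
              (F.subtree false).outputWithin p false d) := by ring
        _ ≤ x * 1 + y * 1 := by gcongr <;> exact ih _
        _ ≤ 1 := by simpa using hxy
    rw [outputWithin_succ, outputWithin_succ]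
    cases h : F.label [] with
    | coin i =>
      have h0 := hp.1 i
      have h1 := hp.2 i
      simp only [Pi.zero_apply, Pi.one_apply] at h0 h1
      simpa [FactoryLabel.edgeProb] using key _ _
        (by rw [← ENNReal.ofReal_add h0 (by linarith)]; simp)
    | const c =>
      have h0 := c.2.1
      have h1 := c.2.2
      simpa [FactoryLabel.edgeProb] using key _ _
        (by rw [← ENNReal.ofReal_add h0.le (by linarith)]; simp)
    | leaf b => cases b <;> simp [FactoryLabel.edgeProb]

theorem outputProb_add_le_one (hp : p ∈ Set.Icc (0 : Fin n → ℝ) 1) :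
    F.outputProb p true + F.outputProb p false ≤ 1 :=
  le_of_tendsto' ((F.tendsto_outputWithin p true).add (F.tendsto_outputWithin p false))
    (F.outputWithin_add_le_one hp)

variable {F}

/-- Since the two output probabilities add up to at most one, lower bounds for both of them which
add up to one are equalities. -/
theorem Simulates.of_le (hp : p ∈ Set.Icc (0 : Fin n → ℝ) 1) {x : ℝ} (hx : x ∈ Set.Icc (0 : ℝ) 1)
    (h1 : ENNReal.ofReal x ≤ F.outputProb p true)
    (h0 : ENNReal.ofReal (1 - x) ≤ F.outputProb p false) : F.Simulates p x := by
  have hsum : ENNReal.ofReal x + ENNReal.ofReal (1 - x) = 1 := by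
    rw [← ENNReal.ofReal_add hx.1 (by linarith [hx.2])]; simp
  have hle := F.outputProb_add_le_one hp
  rw [← hsum] at hle
  constructor
  · refine le_antisymm ?_ h1
    have := (add_le_add_right h0 (F.outputProb p true)).trans hle
    exact (ENNReal.add_le_add_iff_right ENNReal.ofReal_ne_top).1 this
  · refine le_antisymm ?_ h0
    have := (add_le_add_left h1 (F.outputProb p false)).trans hle
    exact (ENNReal.add_le_add_iff_left ENNReal.ofReal_ne_top).1 this

theorem simulates_iff {x : ℝ} (hx : x ∈ Set.Icc (0 : ℝ) 1) :
    F.Simulates p x ↔ F.TerminatesAlmostSurely p ∧ F.outputProb p true = ENNReal.ofReal x := by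
  have hsum : ENNReal.ofReal (1 - x) + ENNReal.ofReal x = 1 := by
    rw [← ENNReal.ofReal_add (by linarith [hx.2]) hx.1]; simp
  constructor
  · rintro ⟨h1, h0⟩
    exact ⟨by rw [TerminatesAlmostSurely, h0, h1, hsum], h1⟩
  · rintro ⟨ht, h1⟩
    refine ⟨h1, ?_⟩
    rw [TerminatesAlmostSurely, h1, ← hsum] at ht
    exact (ENNReal.add_left_inj ENNReal.ofReal_ne_top).1 ht

end BernoulliFactory

/-! ### Sequential composition of factories -/

namespace BernoulliFactory

variable {n : ℕ}

/-- The tree of the executions of an automaton which is started in the state `s`, has the node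
label `lab` in each state, and moves according to `next` after a flip. -/
def unfold {σ : Type*} (lab : σ → FactoryLabel n) (next : σ → Bool → σ) (s : σ) :
    BernoulliFactory n :=
  ⟨fun w => lab (w.foldl next s)⟩

/-- A coin of bias `1 / 2`. In the composition below both of its outcomes have the same
consequence. It separates consecutive runs, so that each transition consumes a flip even if a
factory consists of a single leaf. -/
noncomputable def fairFlip : FactoryLabel n :=
  .const ⟨1 / 2, by norm_num, by norm_num⟩

/-- Node labels of the sequential composition. In the state `inl (k, T)` the rest `T` of the `k`-th
selector is run, in the state `inr T` the rest `T` of the finally selected factory. -/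
noncomputable def chainLabel : (ℕ × BernoulliFactory n) ⊕ BernoulliFactory n → FactoryLabel n
  | .inl (_, T) => match T.label [] with
    | .leaf _ => fairFlip
    | l => l
  | .inr T => T.label []

/-- Transitions of the sequential composition: if the `k`-th selector outputs `1`, then `G k` is
started, and if it outputs `0`, then the next selector is started. -/
def chainNext (S G : ℕ → BernoulliFactory n) :
    (ℕ × BernoulliFactory n) ⊕ BernoulliFactory n → Bool →
      (ℕ × BernoulliFactory n) ⊕ BernoulliFactory n
  | .inl (k, T), e => match T.label [] with
    | .leaf true => .inr (G k)
    | .leaf false => .inl (k + 1, S (k + 1))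
    | _ => .inl (k, T.subtree e)
  | .inr T, e => .inr (T.subtree e)

/-- Run the selectors `S k, S (k + 1), …` until one of them outputs `1`, say `S j`, then run `G j`
and give its output. -/
noncomputable def chain (S G : ℕ → BernoulliFactory n) (k : ℕ) : BernoulliFactory n :=
  unfold chainLabel (chainNext S G) (.inl (k, S k))

theorem unfold_inr (S G : ℕ → BernoulliFactory n) (T : BernoulliFactory n) :
    unfold chainLabel (chainNext S G) (.inr T) = T := by
  have h : ∀ (w : List Bool) (T : BernoulliFactory n),
      (unfold chainLabel (chainNext S G) (.inr T)).label w = T.label w := by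
    intro w
    induction w with
    | nil => exact fun T => rfl
    | cons e w ih => exact fun T => ih (T.subtree e)
  cases T
  exact congrArg BernoulliFactory.mk (funext fun w => h w _)

theorem subtree_unfold {σ : Type*} (lab : σ → FactoryLabel n) (next : σ → Bool → σ) (s : σ)
    (e : Bool) : (unfold lab next s).subtree e = unfold lab next (next s e) := rfl

theorem label_unfold_nil {σ : Type*} (lab : σ → FactoryLabel n) (next : σ → Bool → σ) (s : σ) :
    (unfold lab next s).label [] = lab s := rfl

theorem sum_edgeProb_fairFlip_mul (p : Fin n → ℝ) (x : ENNReal) :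
    ∑ e, (fairFlip : FactoryLabel n).edgeProb p e * x = x := by
  rw [← Finset.sum_mul]
  have : ∑ e, (fairFlip : FactoryLabel n).edgeProb p e = 1 := by
    simp only [Fintype.sum_bool, fairFlip, FactoryLabel.edgeProb]
    rw [← ENNReal.ofReal_add (by norm_num) (by norm_num)]
    norm_num
  rw [this, one_mul]

theorem outputWithin_mul_le_outputProb_unfold (S G : ℕ → BernoulliFactory n) (p : Fin n → ℝ)
    (b : Bool) (k d : ℕ) (T : BernoulliFactory n) :
    T.outputWithin p true d * (G k).outputProb p b +
        T.outputWithin p false d * (chain S G (k + 1)).outputProb p b ≤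
      (unfold chainLabel (chainNext S G) (.inl (k, T))).outputProb p b := by
  induction d generalizing T with
  | zero => simp
  | succ d ih =>
    rw [outputWithin_succ, outputWithin_succ, outputProb_eq (unfold _ _ _)]
    simp only [label_unfold_nil, subtree_unfold]
    have step : ∀ (l : FactoryLabel n),
        (∑ e, l.edgeProb p e * (T.subtree e).outputWithin p true d) * (G k).outputProb p b +
          (∑ e, l.edgeProb p e * (T.subtree e).outputWithin p false d) *
            (chain S G (k + 1)).outputProb p b ≤
        ∑ e, l.edgeProb p e *
          (unfold chainLabel (chainNext S G) (.inl (k, T.subtree e))).outputProb p b := by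
      intro l
      rw [Finset.sum_mul, Finset.sum_mul, ← Finset.sum_add_distrib]
      refine Finset.sum_le_sum fun e _ => ?_
      rw [mul_assoc, mul_assoc, ← mul_add]
      gcongr
      exact ih _
    cases h : T.label [] with
    | coin i => simpa [chainLabel, chainNext, h] using step (.coin i)
    | const c => simpa [chainLabel, chainNext, h] using step (.const c)
    | leaf a =>
      cases a with
      | true =>
        simp only [chainLabel, chainNext, h, unfold_inr, sum_edgeProb_fairFlip_mul]
        simp [FactoryLabel.edgeProb]
      | false =>
        simp only [chainLabel, chainNext, h, sum_edgeProb_fairFlip_mul]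
        simp [FactoryLabel.edgeProb, chain]

theorem outputProb_mul_le_outputProb_chain (S G : ℕ → BernoulliFactory n) {p : Fin n → ℝ}
    (hp : p ∈ Set.Icc (0 : Fin n → ℝ) 1) (b : Bool) (k : ℕ) :
    (S k).outputProb p true * (G k).outputProb p b +
        (S k).outputProb p false * (chain S G (k + 1)).outputProb p b ≤
      (chain S G k).outputProb p b := by
  have hne : ∀ (F : BernoulliFactory n), F.outputProb p b ≠ ⊤ := fun F => by
    refine ne_top_of_le_ne_top ENNReal.one_ne_top (le_trans ?_ (F.outputProb_add_le_one hp))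
    cases b
    · exact le_add_self
    · exact le_self_add
  exact le_of_tendsto' (((ENNReal.Tendsto.mul_const ((S k).tendsto_outputWithin p true)
    (.inr (hne _))).add (ENNReal.Tendsto.mul_const ((S k).tendsto_outputWithin p false)
    (.inr (hne _))))) fun d => outputWithin_mul_le_outputProb_unfold S G p b k d (S k)

/-- The recursion `y k = s k * g k + (1 - s k) * y (k + 1)` bounds the output probabilities of the
composition from below, up to the probability that none of the next `N` selectors outputs `1`. -/
theorem le_outputProb_chain_add {S G : ℕ → BernoulliFactory n} {p : Fin n → ℝ}
    (hp : p ∈ Set.Icc (0 : Fin n → ℝ) 1) {s g y : ℕ → ℝ} {b : Bool}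
    (hs : ∀ k, s k ∈ Set.Icc (0 : ℝ) 1) (hg : ∀ k, 0 ≤ g k) (hy : ∀ k, y k ∈ Set.Icc (0 : ℝ) 1)
    (hS : ∀ k, (S k).Simulates p (s k))
    (hG : ∀ k, ENNReal.ofReal (g k) ≤ (G k).outputProb p b)
    (hrec : ∀ k, y k = s k * g k + (1 - s k) * y (k + 1)) (N k : ℕ) :
    ENNReal.ofReal (y k) ≤ (chain S G k).outputProb p b +
      ENNReal.ofReal (∏ j ∈ Finset.range N, (1 - s (k + j))) := by
  induction N generalizing k with
  | zero =>
    simp only [Finset.range_zero, Finset.prod_empty, ENNReal.ofReal_one]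
    exact (ENNReal.ofReal_le_one.2 (hy k).2).trans le_add_self
  | succ N ih =>
    have hs0 : 0 ≤ 1 - s k := sub_nonneg.2 (hs k).2
    rw [hrec k, ENNReal.ofReal_add (mul_nonneg (hs k).1 (hg k)) (mul_nonneg hs0 (hy _).1),
      ENNReal.ofReal_mul (hs k).1, ENNReal.ofReal_mul hs0, Finset.prod_range_succ',
      mul_comm _ (1 - _),
      ENNReal.ofReal_mul (by simpa using hs0)]
    have h1 := ih (k + 1)
    simp only [add_zero, add_assoc, add_comm 1] at h1 ⊢
    calc _ ≤ ENNReal.ofReal (s k) * (G k).outputProb p b +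
          ENNReal.ofReal (1 - s k) * ((chain S G (k + 1)).outputProb p b +
            ENNReal.ofReal (∏ j ∈ Finset.range N, (1 - s (k + (j + 1))))) := by
          gcongr
          · exact hG k
      _ = (ENNReal.ofReal (s k) * (G k).outputProb p b +
          ENNReal.ofReal (1 - s k) * (chain S G (k + 1)).outputProb p b) +
            ENNReal.ofReal (1 - s k) *
              ENNReal.ofReal (∏ j ∈ Finset.range N, (1 - s (k + (j + 1)))) := by ring
      _ ≤ _ := by
          gcongr
          rw [← (hS k).1, ← (hS k).2]
          exact outputProb_mul_le_outputProb_chain S G hp b k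

theorem Simulates.chain {S G : ℕ → BernoulliFactory n} {p : Fin n → ℝ}
    (hp : p ∈ Set.Icc (0 : Fin n → ℝ) 1) {s g y : ℕ → ℝ}
    (hs : ∀ k, s k ∈ Set.Icc (0 : ℝ) 1) (hg : ∀ k, g k ∈ Set.Icc (0 : ℝ) 1)
    (hy : ∀ k, y k ∈ Set.Icc (0 : ℝ) 1)
    (hS : ∀ k, (S k).Simulates p (s k)) (hG : ∀ k, (G k).Simulates p (g k))
    (hrec : ∀ k, y k = s k * g k + (1 - s k) * y (k + 1))
    (hprod : ∀ η > 0, ∃ N, ∏ j ∈ Finset.range N, (1 - s j) ≤ η) :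
    (chain S G 0).Simulates p (y 0) := by
  -- The error term in `le_outputProb_chain_add` can be made arbitrarily small.
  have lim : ∀ x z : ENNReal, (∀ N, x ≤ z + ENNReal.ofReal (∏ j ∈ Finset.range N, (1 - s j))) →
      x ≤ z := by
    intro x z h
    refine ENNReal.le_of_forall_pos_le_add fun η hη _ => ?_
    obtain ⟨N, hN⟩ := hprod η hη
    refine (h N).trans ?_
    gcongr
    exact (ENNReal.ofReal_le_ofReal hN).trans (by simp)
  refine Simulates.of_le hp (hy 0) (lim _ _ fun N => ?_) (lim _ _ fun N => ?_)
  · simpa using le_outputProb_chain_add hp hs (fun k => (hg k).1) hy hS (fun k => (hG k).1.ge)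
      hrec N 0
  · simpa using le_outputProb_chain_add (y := fun k => 1 - y k) (g := fun k => 1 - g k) hp hs
      (fun k => sub_nonneg.2 (hg k).2)
      (fun k => ⟨sub_nonneg.2 (hy k).2, sub_le_self _ (hy k).1⟩) hS (fun k => (hG k).2.ge)
      (fun k => by rw [hrec k]; ring) N 0

end BernoulliFactory

/-! ### Closure properties of implementable functions -/

/-- `f : K → ℝ` has values in `[0,1]` and is implementable by a Bernoulli factory on `K`. -/
def Realizable {n : ℕ} (K : Set (Fin n → ℝ)) (f : K → ℝ) : Prop :=
  (∀ p, f p ∈ Set.Icc (0 : ℝ) 1) ∧ ∃ F : BernoulliFactory n, ∀ p : K, F.Simulates p (f p)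

theorem realizable_iff {n : ℕ} {K : Set (Fin n → ℝ)} {f : K → ℝ}
    (hf : ∀ p, f p ∈ Set.Icc (0 : ℝ) 1) : Realizable K f ↔ ImplementableByFactory K f := by
  simp only [Realizable, ImplementableByFactory, BernoulliFactory.simulates_iff (hf _)]
  exact and_iff_right hf

namespace Realizable

variable {n : ℕ} {K : Set (Fin n → ℝ)}

theorem bit (b : Bool) : Realizable K fun _ => if b then 1 else 0 := by
  classical
  refine ⟨fun p => by cases b <;> simp, ⟨fun _ => .leaf b⟩, fun p => ?_⟩
  constructor <;> rw [BernoulliFactory.outputProb_eq] <;>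
    cases b <;> simp [FactoryLabel.edgeProb]

theorem one : Realizable K fun _ => 1 := bit true

theorem zero : Realizable K fun _ => 0 := bit false

/-- A single flip whose outcome is the output. -/
theorem of_label (l : FactoryLabel n) {f : K → ℝ} (hf : ∀ p, f p ∈ Set.Icc (0 : ℝ) 1)
    (hl : ∀ b, l ≠ .leaf b) (h1 : ∀ p : K, l.edgeProb p true = ENNReal.ofReal (f p))
    (h0 : ∀ p : K, l.edgeProb p false = ENNReal.ofReal (1 - f p)) : Realizable K f := by
  classical
  let F : BernoulliFactory n := ⟨fun w => match w with
    | [] => l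
    | b :: _ => .leaf b⟩
  have hF : ∀ (p : Fin n → ℝ) (e b : Bool),
      (F.subtree e).outputProb p b = if e = b then 1 else 0 := by
    intro p e b
    have h : (F.subtree e).label [] = .leaf e := rfl
    rw [BernoulliFactory.outputProb_eq, h]
    simp [FactoryLabel.edgeProb]
  refine ⟨hf, F, fun p => ?_⟩
  have h : F.label [] = l := rfl
  constructor <;> rw [BernoulliFactory.outputProb_eq, h]
  · simp [hl, hF, h1]
  · simp [hl, hF, h0]

theorem const {c : ℝ} (hc : c ∈ Set.Icc (0 : ℝ) 1) : Realizable K fun _ => c := by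
  rcases eq_or_lt_of_le hc.1 with h | h0
  · simpa only [← h] using zero
  rcases eq_or_lt_of_le hc.2 with h | h1
  · simpa only [h] using one
  exact of_label (.const ⟨c, h0, h1⟩) (fun _ => hc) (by simp) (fun _ => rfl) (fun _ => rfl)

theorem coord (hK : K ⊆ Set.Icc (0 : Fin n → ℝ) 1) (i : Fin n) :
    Realizable K fun p => (p : Fin n → ℝ) i :=
  of_label (.coin i) (fun p => ⟨(hK p.2).1 i, (hK p.2).2 i⟩) (by simp) (fun _ => rfl) (fun _ => rfl)

/-- The closure property behind all others: sequential composition of countably many factories,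
provided that with probability one some selector `s k` outputs `1`. -/
theorem chain (hK : K ⊆ Set.Icc (0 : Fin n → ℝ) 1) {s g y : ℕ → K → ℝ}
    (hs : ∀ k, Realizable K (s k)) (hg : ∀ k, Realizable K (g k))
    (hy : ∀ k p, y k p ∈ Set.Icc (0 : ℝ) 1)
    (hrec : ∀ k p, y k p = s k p * g k p + (1 - s k p) * y (k + 1) p)
    (hprod : ∀ p, ∀ η > 0, ∃ N, ∏ j ∈ Finset.range N, (1 - s j p) ≤ η) : Realizable K (y 0) := by
  choose hs0 S hS using hs
  choose hg0 G hG using hg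
  exact ⟨hy 0, BernoulliFactory.chain S G 0, fun p =>
    BernoulliFactory.Simulates.chain (hK p.2) (fun k => hs0 k p) (fun k => hg0 k p)
      (y := fun k => y k p) (fun k => hy k p) (fun k => hS k p) (fun k => hG k p)
      (fun k => hrec k p) (hprod p)⟩

variable {x y z : K → ℝ}

/-- Flip an `x`-coin, then a `y`-coin or a `z`-coin, depending on the outcome. -/
theorem ite (hK : K ⊆ Set.Icc (0 : Fin n → ℝ) 1) (hx : Realizable K x) (hy : Realizable K y)
    (hz : Realizable K z) : Realizable K fun p => x p * y p + (1 - x p) * z p := by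
  have hmem : ∀ p, x p * y p + (1 - x p) * z p ∈ Set.Icc (0 : ℝ) 1 := by
    intro p
    obtain ⟨h1, h2⟩ := hx.1 p
    exact (convex_Icc (0 : ℝ) 1) (hy.1 p) (hz.1 p) h1 (sub_nonneg.2 h2) (by ring)
  let s : ℕ → K → ℝ := fun k => if k = 0 then x else fun _ => 1
  let g : ℕ → K → ℝ := fun k => if k = 0 then y else z
  let w : ℕ → K → ℝ := fun k => if k = 0 then fun p => x p * y p + (1 - x p) * z p else z
  refine chain hK (s := s) (g := g) (y := w) (fun k => ?_) (fun k => ?_) (fun k p => ?_)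
    (fun k p => ?_) fun p η hη => ⟨2, ?_⟩
  · by_cases h : k = 0 <;> simp only [s, h, if_true, if_false, hx, one]
  · by_cases h : k = 0 <;> simp only [g, h, if_true, if_false, hy, hz]
  · by_cases h : k = 0
    · simpa only [w, h, if_true] using hmem p
    · simpa only [w, h, if_false] using hz.1 p
  · by_cases h : k = 0 <;> simp [s, g, w, h]
  · simpa [s, Finset.prod_range_succ] using hη.le

theorem congr (hx : Realizable K x) (h : ∀ p, y p = x p) : Realizable K y :=
  (funext h : y = x) ▸ hx

theorem compl (hK : K ⊆ Set.Icc (0 : Fin n → ℝ) 1) (hx : Realizable K x) :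
    Realizable K fun p => 1 - x p :=
  (ite hK hx zero one).congr fun p => by ring

theorem mul (hK : K ⊆ Set.Icc (0 : Fin n → ℝ) 1) (hx : Realizable K x) (hy : Realizable K y) :
    Realizable K fun p => x p * y p :=
  (ite hK hx hy zero).congr fun p => by ring

theorem mix (hK : K ⊆ Set.Icc (0 : Fin n → ℝ) 1) {c : ℝ} (hc : c ∈ Set.Icc (0 : ℝ) 1)
    (hx : Realizable K x) (hy : Realizable K y) : Realizable K fun p => c * x p + (1 - c) * y p :=
  ite hK (const hc) hx hy

theorem pow (hK : K ⊆ Set.Icc (0 : Fin n → ℝ) 1) (hx : Realizable K x) (m : ℕ) :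
    Realizable K fun p => x p ^ m := by
  induction m with
  | zero => simpa using one
  | succ m ih => simpa only [pow_succ] using mul hK ih hx

theorem prod (hK : K ⊆ Set.Icc (0 : Fin n → ℝ) 1) {ι : Type*} (t : Finset ι) {u : ι → K → ℝ}
    (hu : ∀ i, Realizable K (u i)) : Realizable K fun p => ∏ i ∈ t, u i p := by
  classical
  induction t using Finset.induction_on with
  | empty => simpa using one
  | insert i t hi ih => simpa only [Finset.prod_insert hi] using mul hK (hu i) ih

/-- Race of two coins: they are flipped alternately until one of them shows `1`, and the output
tells which. -/
theorem race (hK : K ⊆ Set.Icc (0 : Fin n → ℝ) 1) (hx : Realizable K x) (hy : Realizable K y)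
    (hpos : ∀ p, 0 < x p + y p - x p * y p) :
    Realizable K fun p => x p / (x p + y p - x p * y p) := by
  -- `w k` is the probability that the `x`-coin wins if the next flip is the `k`-th one.
  let s : ℕ → K → ℝ := fun k => if Even k then x else y
  let g : ℕ → K → ℝ := fun k => if Even k then fun _ => 1 else fun _ => 0
  let w : ℕ → K → ℝ := fun k =>
    if Even k then fun p => x p / (x p + y p - x p * y p)
    else fun p => (1 - y p) * (x p / (x p + y p - x p * y p))
  have hmem : ∀ p, x p / (x p + y p - x p * y p) ∈ Set.Icc (0 : ℝ) 1 := by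
    intro p
    obtain ⟨hx0, hx1⟩ := hx.1 p
    obtain ⟨hy0, hy1⟩ := hy.1 p
    refine ⟨div_nonneg hx0 (hpos p).le, (div_le_one (hpos p)).2 ?_⟩
    nlinarith
  suffices h : Realizable K (w 0) by simpa [w] using h
  refine chain hK (s := s) (g := g) (y := w) (fun k => ?_) (fun k => ?_) (fun k p => ?_)
    (fun k p => ?_) fun p η hη => ?_
  · by_cases h : Even k <;> simp only [s, h, if_true, if_false, hx, hy]
  · by_cases h : Even k <;> simp only [g, h, if_true, if_false, one, zero]
  · by_cases h : Even k
    · simpa only [w, h, if_true] using hmem p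
    · simp only [w, h, if_false]
      have := hy.1 p
      exact unitInterval.mul_mem ⟨sub_nonneg.2 this.2, sub_le_self _ this.1⟩ (hmem p)
  · by_cases h : Even k
    · have := (hpos p).ne'
      simp only [s, g, w, h, Nat.even_add_one, if_true, if_false, not_true_eq_false]
      field_simp
      ring
    · simp [s, g, w, h, Nat.even_add_one]
  · have hprod : ∀ N, ∏ j ∈ Finset.range (2 * N), (1 - s j p) = ((1 - x p) * (1 - y p)) ^ N := by
      intro N
      induction N with
      | zero => simp
      | succ N ih =>
        rw [mul_add, mul_one, Finset.prod_range_succ, Finset.prod_range_succ, ih, pow_succ]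
        simp [s, mul_assoc]
    have hlt : (1 - x p) * (1 - y p) < 1 := by linarith [hpos p]
    obtain ⟨N, hN⟩ := exists_pow_lt_of_lt_one hη hlt
    exact ⟨2 * N, (hprod N).trans_le hN.le⟩

/-- Infinite mixture with geometric weights. -/
theorem of_forall_mix (hK : K ⊆ Set.Icc (0 : Fin n → ℝ) 1) {c : ℝ} (hc : c ∈ Set.Ioc (0 : ℝ) 1)
    {g y : ℕ → K → ℝ} (hg : ∀ k, Realizable K (g k)) (hy : ∀ k p, y k p ∈ Set.Icc (0 : ℝ) 1)
    (hrec : ∀ k p, y k p = c * g k p + (1 - c) * y (k + 1) p) : Realizable K (y 0) := by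
  refine chain hK (s := fun _ _ => c) (fun k => const ⟨hc.1.le, hc.2⟩) hg hy hrec fun p η hη => ?_
  obtain ⟨N, hN⟩ := exists_pow_lt_of_lt_one hη (show 1 - c < 1 by linarith [hc.1])
  exact ⟨N, by simpa using hN.le⟩

end Realizable

/-! ### Necessity: continuity and polynomial bounds of implementable functions -/

/-- The polynomial attached to a face of the cube. It is positive on the open face and bounded by
`1` on the cube. -/
noncomputable def faceMonomial {n : ℕ} (A S B : Finset (Fin n)) (p : Fin n → ℝ) : ℝ :=
  (∏ i ∈ A, (1 - p i)) * (∏ i ∈ S, p i) * (∏ i ∈ S, (1 - p i)) * (∏ i ∈ B, p i)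

section FaceMonomial

variable {n : ℕ} {A S B : Finset (Fin n)} {p q : Fin n → ℝ}

theorem prod_coord_mem (hp : p ∈ Set.Icc (0 : Fin n → ℝ) 1) (t : Finset (Fin n)) :
    ∏ i ∈ t, p i ∈ Set.Icc (0 : ℝ) 1 :=
  ⟨Finset.prod_nonneg fun i _ => hp.1 i, Finset.prod_le_one (fun i _ => hp.1 i) fun i _ => hp.2 i⟩

theorem one_sub_mem_cube (hp : p ∈ Set.Icc (0 : Fin n → ℝ) 1) :
    (1 - p) ∈ Set.Icc (0 : Fin n → ℝ) 1 :=
  ⟨sub_nonneg.2 hp.2, sub_le_self _ hp.1⟩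

theorem faceMonomial_mem (hp : p ∈ Set.Icc (0 : Fin n → ℝ) 1) :
    faceMonomial A S B p ∈ Set.Icc (0 : ℝ) 1 :=
  unitInterval.mul_mem (unitInterval.mul_mem (unitInterval.mul_mem
    (prod_coord_mem (one_sub_mem_cube hp) A) (prod_coord_mem hp S))
    (prod_coord_mem (one_sub_mem_cube hp) S)) (prod_coord_mem hp B)

theorem faceMonomial_pos (hp : p ∈ openFace A S B) : 0 < faceMonomial A S B p := by
  obtain ⟨-, hA, hS, hB⟩ := hp
  have h1 : ∏ i ∈ A, (1 - p i) = 1 := Finset.prod_eq_one fun i hi => by rw [hA i hi, sub_zero]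
  have h2 : ∏ i ∈ B, p i = 1 := Finset.prod_eq_one hB
  rw [faceMonomial, h1, h2, one_mul, mul_one]
  exact mul_pos (Finset.prod_pos fun i hi => (hS i hi).1)
    (Finset.prod_pos fun i hi => sub_pos.2 (hS i hi).2)

theorem prod_coord_le (hp : p ∈ Set.Icc (0 : Fin n → ℝ) 1) {t : Finset (Fin n)} {i : Fin n}
    (hi : i ∈ t) : ∏ j ∈ t, p j ≤ p i := by
  rw [← Finset.mul_prod_erase t p hi]
  exact mul_le_of_le_one_right (hp.1 i) (prod_coord_mem hp _).2

theorem faceMonomial_le_coord (hp : p ∈ Set.Icc (0 : Fin n → ℝ) 1) {i : Fin n}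
    (hi : i ∈ S ∨ i ∈ B) : faceMonomial A S B p ≤ p i := by
  have hA := prod_coord_mem (one_sub_mem_cube hp) A
  have hS := prod_coord_mem hp S
  have hS' := prod_coord_mem (one_sub_mem_cube hp) S
  have hB := prod_coord_mem hp B
  rcases hi with hi | hi
  · refine le_trans ?_ (prod_coord_le hp hi)
    rw [faceMonomial]
    exact (mul_le_of_le_one_right (mul_nonneg (mul_nonneg hA.1 hS.1) hS'.1) hB.2).trans
      ((mul_le_of_le_one_right (mul_nonneg hA.1 hS.1) hS'.2).trans
        (mul_le_of_le_one_left hS.1 hA.2))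
  · refine le_trans ?_ (prod_coord_le hp hi)
    exact mul_le_of_le_one_left hB.1
      (unitInterval.mul_mem (unitInterval.mul_mem hA hS) hS').2

/-- Reflection of the cube exchanges the roles of `A` and `B`. -/
theorem faceMonomial_one_sub (A S B : Finset (Fin n)) (p : Fin n → ℝ) :
    faceMonomial B S A (1 - p) = faceMonomial A S B p := by
  simp only [faceMonomial, Pi.sub_apply, Pi.one_apply, sub_sub_cancel]
  ring

theorem faceMonomial_le_one_sub_coord (hp : p ∈ Set.Icc (0 : Fin n → ℝ) 1) {i : Fin n}
    (hi : i ∈ A ∨ i ∈ S) : faceMonomial A S B p ≤ 1 - p i := by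
  rw [← faceMonomial_one_sub]
  exact faceMonomial_le_coord (one_sub_mem_cube hp) hi.symm

theorem exists_isFacePartition_mem_openFace (hp : p ∈ Set.Icc (0 : Fin n → ℝ) 1) :
    ∃ A S B, IsFacePartition A S B ∧ p ∈ openFace A S B := by
  classical
  refine ⟨Finset.univ.filter (p · = 0), Finset.univ.filter fun i => 0 < p i ∧ p i < 1,
    Finset.univ.filter (p · = 1), ⟨?_, ?_, ?_, ?_⟩, hp, ?_, ?_, ?_⟩
  · refine Finset.disjoint_left.2 fun i h1 h2 => ?_
    simp only [Finset.mem_filter_univ] at h1 h2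
    linarith
  · refine Finset.disjoint_left.2 fun i h1 h2 => ?_
    simp only [Finset.mem_filter_univ] at h1 h2
    linarith
  · refine Finset.disjoint_left.2 fun i h1 h2 => ?_
    simp only [Finset.mem_filter_univ] at h1 h2
    linarith
  · ext i
    simp only [Finset.mem_union, Finset.mem_filter_univ, Finset.mem_univ, iff_true]
    rcases eq_or_lt_of_le (show 0 ≤ p i from hp.1 i) with h | h
    · exact .inl (.inl h.symm)
    · rcases eq_or_lt_of_le (show p i ≤ 1 from hp.2 i) with h' | h'
      · exact .inr h'
      · exact .inl (.inr ⟨h, h'⟩)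
  · simp
  · simp
  · simp

theorem FactoryLabel.exists_faceMonomial_le_edgeProb (hT : IsFacePartition A S B)
    (hq : q ∈ openFace A S B) (l : FactoryLabel n) (e : Bool) (h : 0 < l.edgeProb q e) :
    ∃ c : ℝ, 0 < c ∧ ∀ p ∈ Set.Icc (0 : Fin n → ℝ) 1,
      ENNReal.ofReal (c * faceMonomial A S B p) ≤ l.edgeProb p e := by
  obtain ⟨-, hA, -, hB⟩ := hq
  have hcover : ∀ i, (i ∈ A ∨ i ∈ S) ∨ i ∈ B := fun i => by
    have := Finset.mem_univ i
    rwa [← hT.2.2.2, Finset.mem_union, Finset.mem_union] at this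
  cases l with
  | leaf b => exact absurd h (by simp [FactoryLabel.edgeProb])
  | coin i =>
    refine ⟨1, one_pos, fun p hp => ?_⟩
    rw [one_mul]
    cases e with
    | true =>
      refine ENNReal.ofReal_le_ofReal (faceMonomial_le_coord hp ?_)
      rcases hcover i with (hi | hi) | hi
      · exact absurd h (by simp [FactoryLabel.edgeProb, hA i hi])
      · exact .inl hi
      · exact .inr hi
    | false =>
      refine ENNReal.ofReal_le_ofReal (faceMonomial_le_one_sub_coord hp ?_)
      rcases hcover i with hi | hi
      · exact hi
      · exact absurd h (by simp [FactoryLabel.edgeProb, hB i hi])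
  | const c =>
    cases e with
    | true =>
      exact ⟨c, c.2.1, fun p hp => ENNReal.ofReal_le_ofReal
        (mul_le_of_le_one_right c.2.1.le (faceMonomial_mem hp).2)⟩
    | false =>
      exact ⟨1 - c, sub_pos.2 c.2.2, fun p hp => ENNReal.ofReal_le_ofReal
        (mul_le_of_le_one_right (sub_pos.2 c.2.2).le (faceMonomial_mem hp).2)⟩

theorem BernoulliFactory.exists_faceMonomial_pow_le_reachProb (hT : IsFacePartition A S B)
    (hq : q ∈ openFace A S B) (w : List Bool) (F : BernoulliFactory n) (h : 0 < F.reachProb q w) :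
    ∃ c : ℝ, 0 < c ∧ ∀ p ∈ Set.Icc (0 : Fin n → ℝ) 1,
      ENNReal.ofReal (c * faceMonomial A S B p ^ w.length) ≤ F.reachProb p w := by
  induction w generalizing F with
  | nil => exact ⟨1, one_pos, fun p _ => by simp [reachProb]⟩
  | cons e w ih =>
    rw [reachProb, CanonicallyOrderedAdd.mul_pos] at h
    obtain ⟨c, hc, hl⟩ := FactoryLabel.exists_faceMonomial_le_edgeProb hT hq _ e h.1
    obtain ⟨d, hd, hw⟩ := ih _ h.2
    refine ⟨c * d, mul_pos hc hd, fun p hp => ?_⟩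
    rw [reachProb]
    refine le_trans (le_of_eq ?_) (mul_le_mul' (hl p hp) (hw p hp))
    rw [← ENNReal.ofReal_mul (mul_nonneg hc.le (faceMonomial_mem hp).1), List.length_cons]
    congr 1
    ring

end FaceMonomial

section Necessity

variable {n : ℕ} {K : Set (Fin n → ℝ)}

/-- A single leaf which is reached with positive probability somewhere on a face gives the
bound for this face. -/
theorem polynomiallyBounded_of_outputProb (hK : K ⊆ Set.Icc (0 : Fin n → ℝ) 1) {g : K → ℝ}
    (hg : ∀ p, 0 ≤ g p) (F : BernoulliFactory n) (b : Bool)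
    (h : ∀ p : K, F.outputProb p b = ENNReal.ofReal (g p)) : PolynomiallyBounded K g := by
  have hface : ∀ T : Finset (Fin n) × Finset (Fin n) × Finset (Fin n), ∃ (m : ℕ) (c : ℝ), 0 < c ∧
      (IsFacePartition T.1 T.2.1 T.2.2 →
      (∃ q : K, (q : Fin n → ℝ) ∈ openFace T.1 T.2.1 T.2.2 ∧ 0 < g q) →
        ∀ p : K, c * faceMonomial T.1 T.2.1 T.2.2 p ^ m ≤ g p) := by
    rintro ⟨A, S, B⟩
    by_cases hex : IsFacePartition A S B ∧
      ∃ q : K, (q : Fin n → ℝ) ∈ openFace A S B ∧ 0 < g q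
    · obtain ⟨hT, q, hq, hgq⟩ := hex
      have hne : F.outputProb q b ≠ 0 := by simpa [h] using hgq
      obtain ⟨w, hw⟩ : ∃ w : {w : List Bool // F.label w = .leaf b}, F.reachProb q w ≠ 0 := by
        simpa [BernoulliFactory.outputProb] using hne
      obtain ⟨c, hc, hle⟩ := BernoulliFactory.exists_faceMonomial_pow_le_reachProb hT hq _ F
        (pos_iff_ne_zero.2 hw)
      refine ⟨w.1.length, c, hc, fun _ _ p => ?_⟩
      rw [← ENNReal.ofReal_le_ofReal_iff (hg p), ← h p]
      exact (hle p (hK p.2)).trans (ENNReal.le_tsum w)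
    · exact ⟨0, 1, one_pos, fun h1 h2 => absurd ⟨h1, h2⟩ hex⟩
  choose m c hc hface using hface
  obtain ⟨T₁, hm⟩ := Finite.exists_max m
  obtain ⟨T₂, hc'⟩ := Finite.exists_min c
  refine ⟨m T₁, c T₂, hc T₂, fun A S B hT hex p => le_trans ?_ (hface (A, S, B) hT hex p)⟩
  have hM := faceMonomial_mem (A := A) (S := S) (B := B) (hK p.2)
  exact mul_le_mul (hc' _) (pow_le_pow_of_le_one hM.1 hM.2 (hm _)) (pow_nonneg hM.1 _) (hc _).le

theorem FactoryLabel.continuous_edgeProb (l : FactoryLabel n) (e : Bool) :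
    Continuous fun p => l.edgeProb p e := by
  cases l <;> cases e <;> simp only [FactoryLabel.edgeProb]
  case coin.false => exact ENNReal.continuous_ofReal.comp (by fun_prop)
  case coin.true => exact ENNReal.continuous_ofReal.comp (by fun_prop)
  all_goals exact continuous_const

theorem FactoryLabel.edgeProb_ne_top (l : FactoryLabel n) (p : Fin n → ℝ) (e : Bool) :
    l.edgeProb p e ≠ ⊤ := by
  cases l <;> cases e <;> simp [FactoryLabel.edgeProb]

theorem BernoulliFactory.reachProb_ne_top (F : BernoulliFactory n) (p : Fin n → ℝ)
    (w : List Bool) : F.reachProb p w ≠ ⊤ := by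
  induction w generalizing F with
  | nil => simp [reachProb]
  | cons e w ih => exact ENNReal.mul_ne_top (FactoryLabel.edgeProb_ne_top _ _ _) (ih _)

theorem BernoulliFactory.continuous_reachProb (F : BernoulliFactory n) (w : List Bool) :
    Continuous fun p => F.reachProb p w := by
  induction w generalizing F with
  | nil => exact continuous_const
  | cons e w ih =>
    exact (FactoryLabel.continuous_edgeProb _ e).ennreal_mul (ih _)
      (fun p => .inr (reachProb_ne_top _ _ _))
      (fun p => .inr (FactoryLabel.edgeProb_ne_top _ _ _))

theorem lowerSemicontinuous_of_outputProb {g : K → ℝ} (hg : ∀ p, 0 ≤ g p)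
    (F : BernoulliFactory n) (b : Bool) (h : ∀ p : K, F.outputProb p b = ENNReal.ofReal (g p)) :
    LowerSemicontinuous g := by
  have hlsc : LowerSemicontinuous fun p : K => F.outputProb p b :=
    lowerSemicontinuous_tsum fun w =>
      ((F.continuous_reachProb w).comp continuous_subtype_val).lowerSemicontinuous
  intro p a ha
  rcases lt_or_ge a 0 with ha0 | ha0
  · exact Filter.Eventually.of_forall fun q => ha0.trans_le (hg q)
  · have := hlsc p (ENNReal.ofReal a)
      (by simpa only [h, ENNReal.ofReal_lt_ofReal_iff_of_nonneg ha0] using ha)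
    simpa only [h, ENNReal.ofReal_lt_ofReal_iff_of_nonneg ha0] using this

/-- The probabilities of both outputs are lower semicontinuous, as sums of nonnegative continuous
functions, and they add up to one. -/
theorem Realizable.continuous {f : K → ℝ} (hf : Realizable K f) : Continuous f := by
  obtain ⟨h01, F, hF⟩ := hf
  have h1 := lowerSemicontinuous_of_outputProb (fun p => (h01 p).1) F true fun p => (hF p).1
  have h0 := lowerSemicontinuous_of_outputProb (fun p => sub_nonneg.2 (h01 p).2) F false
    fun p => (hF p).2
  refine continuous_iff_lower_upperSemicontinuous.2 ⟨h1, fun p a ha => ?_⟩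
  filter_upwards [h0 p (1 - a) (by linarith)] with q hq
  linarith

theorem Realizable.polynomiallyBounded (hK : K ⊆ Set.Icc (0 : Fin n → ℝ) 1) {f : K → ℝ}
    (hf : Realizable K f) : PolynomiallyBounded K f := by
  obtain ⟨h01, F, hF⟩ := hf
  exact polynomiallyBounded_of_outputProb hK (fun p => (h01 p).1) F true fun p => (hF p).1

end Necessity

/-! ### Approximation of continuous functions by perturbations of a fair coin -/

section Approximation

variable {n : ℕ} {K : Set (Fin n → ℝ)}

/-- Mixing with a fair coin shrinks a perturbation of the fair coin. -/
theorem Realizable.scale (hK : K ⊆ Set.Icc (0 : Fin n → ℝ) 1) {φ : K → ℝ} {a b : ℝ} (hb : 0 ≤ b)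
    (hba : b ≤ a) (ha : 0 < a) (h : Realizable K fun p => 1 / 2 + a * φ p) :
    Realizable K fun p => 1 / 2 + b * φ p :=
  (mix hK ⟨div_nonneg hb ha.le, (div_le_one ha).2 hba⟩ h (const (c := 1 / 2) (by norm_num))).congr
    fun p => by field_simp; ring

/-- The continuous functions `φ` on `K` for which `1 / 2 + a * φ` is implementable for some
`a > 0`. Averaging implements sums, and testing two independent outputs for equality implements
products. -/
def perturbationSubalgebra (hK : K ⊆ Set.Icc (0 : Fin n → ℝ) 1) : Subalgebra ℝ C(K, ℝ) where
  carrier := {φ | ∃ a : ℝ, 0 < a ∧ Realizable K fun p => 1 / 2 + a * φ p}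
  mul_mem' := by
    rintro φ ψ ⟨a, ha, hφ⟩ ⟨b, hb, hψ⟩
    have hc : 0 < min a b := lt_min ha hb
    have hφ' := hφ.scale hK hc.le (min_le_left a b) ha
    have hψ' := hψ.scale hK hc.le (min_le_right a b) hb
    refine ⟨2 * min a b ^ 2, by positivity, (hφ'.ite hK hψ' (hψ'.compl hK)).congr fun p => ?_⟩
    simp only [ContinuousMap.mul_apply]
    ring
  add_mem' := by
    rintro φ ψ ⟨a, ha, hφ⟩ ⟨b, hb, hψ⟩
    have hc : 0 < min a b := lt_min ha hb
    have hφ' := hφ.scale hK hc.le (min_le_left a b) ha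
    have hψ' := hψ.scale hK hc.le (min_le_right a b) hb
    refine ⟨min a b / 2, by positivity,
      (hφ'.mix hK (c := 1 / 2) (by norm_num) hψ').congr fun p => ?_⟩
    simp only [ContinuousMap.add_apply]
    ring
  algebraMap_mem' := by
    intro r
    have h : 0 < 2 * (|r| + 1) := by positivity
    refine ⟨1 / (2 * (|r| + 1)), by positivity,
      (Realizable.const (c := 1 / 2 + 1 / (2 * (|r| + 1)) * r) ⟨?_, ?_⟩).congr fun p => rfl⟩
    · have : -(1 / 2) ≤ r / (2 * (|r| + 1)) := by
        rw [le_div_iff₀ h]; linarith [neg_abs_le r]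
      linarith [one_div_mul_eq_div (2 * (|r| + 1)) r]
    · have : r / (2 * (|r| + 1)) ≤ 1 / 2 := by
        rw [div_le_iff₀ h]; linarith [le_abs_self r]
      linarith [one_div_mul_eq_div (2 * (|r| + 1)) r]

theorem perturbationSubalgebra_separatesPoints (hK : K ⊆ Set.Icc (0 : Fin n → ℝ) 1) :
    (perturbationSubalgebra hK).SeparatesPoints := by
  intro p q hpq
  obtain ⟨i, hi⟩ := Function.ne_iff.1 (Subtype.coe_injective.ne hpq)
  refine ⟨_, ⟨⟨fun r : K => (r : Fin n → ℝ) i - 1 / 2,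
      ((continuous_apply i).comp continuous_subtype_val).sub continuous_const⟩,
    ⟨1, one_pos, (Realizable.coord hK i).congr fun r => ?_⟩, rfl⟩, ?_⟩
  · simp
  · simpa using hi

/-- A coin which is biased towards `0` where `f` is small and towards `1` where `f` is large. -/
theorem exists_realizable_separating (hKc : IsCompact K) (hK : K ⊆ Set.Icc (0 : Fin n → ℝ) 1)
    {f : K → ℝ} (hf : Continuous f) :
    ∃ x : K → ℝ, Realizable K x ∧ (∀ p, 0 < x p ∧ x p < 1) ∧ ∃ ρ : ℝ, 0 ≤ ρ ∧ ρ < 1 ∧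
      (∀ p, f p ≤ 1 / 4 → x p ≤ ρ * (1 - x p)) ∧ ∀ p, 3 / 4 ≤ f p → 1 - x p ≤ ρ * x p := by
  have : CompactSpace K := isCompact_iff_compactSpace.1 hKc
  obtain ⟨⟨φ, a₀, ha₀, hφ⟩, hφf⟩ :=
    ContinuousMap.exists_mem_subalgebra_near_continuous_of_separatesPoints
      (perturbationSubalgebra hK) (perturbationSubalgebra_separatesPoints hK)
      (fun p => f p - 1 / 2) (hf.sub continuous_const) (1 / 8) (by norm_num)
  obtain ⟨a, ha, ha1, haa⟩ : ∃ a : ℝ, 0 < a ∧ a ≤ 1 ∧ a ≤ a₀ :=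
    ⟨min 1 a₀, lt_min one_pos ha₀, min_le_left _ _, min_le_right _ _⟩
  have hφa := hφ.scale hK ha.le haa ha₀
  -- Halving the perturbation keeps the bias away from the end points `0` and `1`.
  refine ⟨fun p => 1 / 2 + a / 2 * φ p, hφ.scale hK (by positivity) (by linarith) ha₀,
    fun p => ?_, (1 / 2 - a / 16) / (1 / 2 + a / 16),
    div_nonneg (by linarith) (by positivity), (div_lt_one (by positivity)).2 (by linarith),
    fun p hp => ?_, fun p hp => ?_⟩
  · have := hφa.1 p
    constructor <;> linarith [this.1, this.2]
  all_goals
    have h1 := abs_lt.1 (hφf p)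
    simp only at h1
    rw [div_mul_eq_mul_div, le_div_iff₀ (by positivity)]
  · have : a * φ p ≤ a * (-(1 / 8)) := mul_le_mul_of_nonneg_left (by linarith [h1.2]) ha.le
    linarith
  · have : a * (1 / 8) ≤ a * φ p := mul_le_mul_of_nonneg_left (by linarith [h1.1]) ha.le
    linarith

end Approximation

/-! ### Sufficiency: factories for admissible functions -/

section Sufficiency

variable {n : ℕ} {K : Set (Fin n → ℝ)}

/-- A polynomially bounded function dominates an implementable function with the same zeros,
namely a mixture of multiples of powers of face monomials. -/
theorem PolynomiallyBounded.exists_realizable_le (hK : K ⊆ Set.Icc (0 : Fin n → ℝ) 1) {g : K → ℝ}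
    (hg : ∀ p, 0 ≤ g p) (h : PolynomiallyBounded K g) :
    ∃ u : K → ℝ, Realizable K u ∧ (∀ p, u p ≤ g p) ∧ ∀ p, 0 < g p → 0 < u p := by
  classical
  obtain ⟨m, c, hc, h⟩ := h
  have hface : ∀ T : Finset (Fin n) × Finset (Fin n) × Finset (Fin n), ∃ u : K → ℝ,
      Realizable K u ∧ (∀ p, u p ≤ g p) ∧ (IsFacePartition T.1 T.2.1 T.2.2 →
        ∀ p : K, (p : Fin n → ℝ) ∈ openFace T.1 T.2.1 T.2.2 → 0 < g p → 0 < u p) := by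
    rintro ⟨A, S, B⟩
    by_cases hex : IsFacePartition A S B ∧
      ∃ q : K, (q : Fin n → ℝ) ∈ openFace A S B ∧ 0 < g q
    · have hM : Realizable K fun p => faceMonomial A S B (p : Fin n → ℝ) :=
        (((Realizable.prod hK A fun i => (Realizable.coord hK i).compl hK).mul hK
          (Realizable.prod hK S fun i => Realizable.coord hK i)).mul hK
          (Realizable.prod hK S fun i => (Realizable.coord hK i).compl hK)).mul hK
          (Realizable.prod hK B fun i => Realizable.coord hK i)
      refine ⟨fun p => min c 1 * faceMonomial A S B (p : Fin n → ℝ) ^ m,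
        (Realizable.const ⟨(lt_min hc one_pos).le, min_le_right c 1⟩).mul hK (hM.pow hK m),
        fun p => ?_, fun _ p hp _ => ?_⟩
      · exact (mul_le_mul_of_nonneg_right (min_le_left c 1) (pow_nonneg (hM.1 p).1 m)).trans
          (h A S B hex.1 hex.2 p)
      · exact mul_pos (lt_min hc one_pos) (pow_pos (faceMonomial_pos hp) m)
    · exact ⟨fun _ => 0, Realizable.zero, hg, fun hT p hp hgp => absurd ⟨hT, p, hp, hgp⟩ hex⟩
  choose u hu hug hupos using hface
  have hmix : ∀ t : Finset (Finset (Fin n) × Finset (Fin n) × Finset (Fin n)), ∃ v : K → ℝ,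
      Realizable K v ∧ (∀ p, v p ≤ g p) ∧ ∀ T ∈ t, ∀ p, 0 < u T p → 0 < v p := by
    intro t
    induction t using Finset.induction_on with
    | empty => exact ⟨fun _ => 0, Realizable.zero, hg, by simp⟩
    | insert T t _ ih =>
      obtain ⟨v, hv, hvg, hvpos⟩ := ih
      refine ⟨_, (hu T).mix hK (c := 1 / 2) (by norm_num) hv, fun p => ?_, fun T' hT' p hp => ?_⟩
      · linarith [hug T p, hvg p]
      · have h1 := ((hu T).1 p).1
        have h2 := (hv.1 p).1
        rcases Finset.mem_insert.1 hT' with rfl | hT'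
        · linarith
        · linarith [hvpos T' hT' p hp]
  obtain ⟨v, hv, hvg, hvpos⟩ := hmix Finset.univ
  refine ⟨v, hv, hvg, fun p hp => ?_⟩
  obtain ⟨A, S, B, hT, hpT⟩ := exists_isFacePartition_mem_openFace (hK p.2)
  exact hvpos (A, S, B) (Finset.mem_univ _) p (hupos (A, S, B) hT p hpT hp)

/-- A continuous function is bounded below by a positive constant on a closed set on which it is
positive. -/
theorem exists_pos_forall_le [CompactSpace K] {u g : K → ℝ} (hu : Continuous u)
    (hg : Continuous g) (a : ℝ) (h : ∀ p, g p ≤ a → 0 < u p) :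
    ∃ δ : ℝ, 0 < δ ∧ ∀ p, g p ≤ a → δ ≤ u p := by
  have hcl : IsCompact {p | g p ≤ a} := (isClosed_le hg continuous_const).isCompact
  rcases Set.eq_empty_or_nonempty {p | g p ≤ a} with he | hne
  · exact ⟨1, one_pos, fun p hp => absurd (show p ∈ {p | g p ≤ a} from hp) (he ▸ id)⟩
  · obtain ⟨q, hq, hmin⟩ := hcl.exists_isMinOn hne hu.continuousOn
    exact ⟨u q, h q hq, fun p hp => hmin hp⟩

/-- A crude implementable substitute `g` for `f` with `g ≤ f` where `f` is small and
`1 - g ≤ 1 - f` where `f` is large. If `u ≤ f` and `v ≤ 1 - f` are implementable with the same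
zeros, it is the outcome of a race of `u x ^ r` against `v (1 - x) ^ r`, where the separating coin
`x` with a large power `r` compensates for a small value of `v` where `f` is small, and of `u` where
`f` is large. -/
theorem exists_realizable_approx (hKc : IsCompact K) (hK : K ⊆ Set.Icc (0 : Fin n → ℝ) 1)
    {f : K → ℝ} (hf : ∀ p, f p ∈ Set.Icc (0 : ℝ) 1) (hcont : Continuous f)
    (h1 : PolynomiallyBounded K f) (h0 : PolynomiallyBounded K fun p => 1 - f p) :
    ∃ g : K → ℝ, Realizable K g ∧ (∀ p, f p ≤ 1 / 4 → g p ≤ f p) ∧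
      ∀ p, 3 / 4 ≤ f p → 1 - g p ≤ 1 - f p := by
  have : CompactSpace K := isCompact_iff_compactSpace.1 hKc
  obtain ⟨u, hu, huf, hupos⟩ := h1.exists_realizable_le hK fun p => (hf p).1
  obtain ⟨v, hv, hvf, hvpos⟩ := h0.exists_realizable_le hK fun p => sub_nonneg.2 (hf p).2
  obtain ⟨δ, hδ, hvδ⟩ := exists_pos_forall_le hv.continuous hcont (1 / 4)
    fun p hp => hvpos p (by linarith)
  obtain ⟨ε, hε, huε⟩ := exists_pos_forall_le hu.continuous hcont.neg (-(3 / 4))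
    fun p hp => hupos p (by simp only [Pi.neg_apply] at hp; linarith)
  obtain ⟨x, hx, hx01, ρ, hρ0, hρ1, hxlow, hxhigh⟩ := exists_realizable_separating hKc hK hcont
  obtain ⟨r, hr⟩ := exists_pow_lt_of_lt_one (lt_min hδ hε) hρ1
  have hU : Realizable K fun p => u p * x p ^ r := hu.mul hK (hx.pow hK r)
  have hV : Realizable K fun p => v p * (1 - x p) ^ r := hv.mul hK ((hx.compl hK).pow hK r)
  set U : K → ℝ := fun p => u p * x p ^ r with hUdef
  set V : K → ℝ := fun p => v p * (1 - x p) ^ r with hVdef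
  have hxr : ∀ p, 0 < x p ^ r := fun p => pow_pos (hx01 p).1 r
  have hyr : ∀ p, 0 < (1 - x p) ^ r := fun p => pow_pos (sub_pos.2 (hx01 p).2) r
  have hUlow : ∀ p, f p ≤ 1 / 4 → U p ≤ u p * V p := by
    intro p hp
    refine mul_le_mul_of_nonneg_left ?_ (hu.1 p).1
    calc x p ^ r ≤ (ρ * (1 - x p)) ^ r := pow_le_pow_left₀ (hx01 p).1.le (hxlow p hp) r
      _ = ρ ^ r * (1 - x p) ^ r := mul_pow _ _ _
      _ ≤ v p * (1 - x p) ^ r := mul_le_mul_of_nonneg_right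
          ((hr.le.trans (min_le_left _ _)).trans (hvδ p hp)) (hyr p).le
  have hVhigh : ∀ p, 3 / 4 ≤ f p → V p ≤ v p * U p := by
    intro p hp
    refine mul_le_mul_of_nonneg_left ?_ (hv.1 p).1
    calc (1 - x p) ^ r ≤ (ρ * x p) ^ r :=
          pow_le_pow_left₀ (sub_nonneg.2 (hx01 p).2.le) (hxhigh p hp) r
      _ = ρ ^ r * x p ^ r := mul_pow _ _ _
      _ ≤ u p * x p ^ r := mul_le_mul_of_nonneg_right
          ((hr.le.trans (min_le_right _ _)).trans (huε p (neg_le_neg hp))) (hxr p).le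
  have hpos : ∀ p, 0 < U p + V p - U p * V p := by
    intro p
    obtain ⟨hU0, hU1⟩ := hU.1 p
    obtain ⟨hV0, hV1⟩ := hV.1 p
    rcases lt_or_ge 0 (f p) with hp | hp
    · have : 0 < U p := mul_pos (hupos p hp) (hxr p)
      nlinarith
    · have : 0 < V p := mul_pos (hvpos p (by linarith)) (hyr p)
      nlinarith
  refine ⟨_, hU.race hK hV hpos, fun p hp => ?_, fun p hp => ?_⟩
  · obtain ⟨hU0, hU1⟩ := hU.1 p
    obtain ⟨hV0, hV1⟩ := hV.1 p
    refine le_trans ((div_le_iff₀ (hpos p)).2 ?_) (huf p)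
    refine (hUlow p hp).trans (mul_le_mul_of_nonneg_left ?_ (hu.1 p).1)
    nlinarith
  · obtain ⟨hU0, hU1⟩ := hU.1 p
    obtain ⟨hV0, hV1⟩ := hV.1 p
    refine le_trans ?_ (hvf p)
    rw [one_sub_div (hpos p).ne', div_le_iff₀ (hpos p)]
    have h2 : v p * U p ≤ v p * (U p + V p - U p * V p) :=
      mul_le_mul_of_nonneg_left (by nlinarith) (hv.1 p).1
    nlinarith [hVhigh p hp, mul_nonneg hU0 hV0]

theorem PolynomiallyBounded.of_half_le {f g : K → ℝ} (hf : PolynomiallyBounded K f)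
    (h : ∀ p, f p / 2 ≤ g p) (h0 : ∀ p, 0 < g p → 0 < f p) : PolynomiallyBounded K g := by
  obtain ⟨m, c, hc, hf⟩ := hf
  refine ⟨m, c / 2, half_pos hc, fun A S B hT ⟨q, hq, hgq⟩ p => ?_⟩
  have := hf A S B hT ⟨q, hq, h0 q hgq⟩ p
  linarith [h p]

/-- The analytic conditions on `f` in the characterization of implementable functions. -/
def Admissible (K : Set (Fin n → ℝ)) (f : K → ℝ) : Prop :=
  (∀ p, f p ∈ Set.Icc (0 : ℝ) 1) ∧ Continuous f ∧ PolynomiallyBounded K f ∧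
    PolynomiallyBounded K fun p => 1 - f p

/-- An admissible function is a mixture, with fixed weights, of an implementable function and
another admissible function. -/
theorem Admissible.exists_mix (hKc : IsCompact K) (hK : K ⊆ Set.Icc (0 : Fin n → ℝ) 1)
    {f : K → ℝ} (hf : Admissible K f) :
    ∃ g f' : K → ℝ, Realizable K g ∧ Admissible K f' ∧
      ∀ p, f p = 1 / 8 * g p + (1 - 1 / 8) * f' p := by
  obtain ⟨h01, hcont, h1, h0⟩ := hf
  obtain ⟨g, hg, hlow, hhigh⟩ := exists_realizable_approx hKc hK h01 hcont h1 h0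
  have hlb : ∀ p, f p / 2 ≤ f p - g p / 8 := by
    intro p
    rcases le_total (f p) (1 / 4) with hp | hp
    · linarith [hlow p hp, (h01 p).1]
    · linarith [(hg.1 p).2]
  have hub : ∀ p, (1 - f p) / 2 ≤ (1 - f p) - (1 - g p) / 8 := by
    intro p
    rcases le_total (3 / 4) (f p) with hp | hp
    · linarith [hhigh p hp, (h01 p).2]
    · linarith [(hg.1 p).1]
  refine ⟨g, fun p => (f p - g p / 8) / (7 / 8), hg, ⟨fun p => ⟨?_, ?_⟩, ?_, ?_, ?_⟩,
    fun p => by ring⟩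
  · linarith [hlb p, (h01 p).1]
  · linarith [hub p, (h01 p).2]
  · have := hg.continuous
    fun_prop
  · refine h1.of_half_le (fun p => ?_) fun p hp => ?_
    · linarith [hlb p, (h01 p).1]
    · linarith [(hg.1 p).1]
  · refine h0.of_half_le (fun p => ?_) fun p hp => ?_
    · linarith [hub p, (h01 p).2]
    · linarith [(hg.1 p).2]

theorem Admissible.realizable (hKc : IsCompact K) (hK : K ⊆ Set.Icc (0 : Fin n → ℝ) 1)
    {f : K → ℝ} (hf : Admissible K f) : Realizable K f := by
  choose! g next hg hnext hmix using fun (f : K → ℝ) (hf : Admissible K f) =>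
    hf.exists_mix hKc hK
  have hadm : ∀ k, Admissible K (next^[k] f) := by
    intro k
    induction k with
    | zero => exact hf
    | succ k ih => rw [Function.iterate_succ_apply']; exact hnext _ ih
  exact Realizable.of_forall_mix hK (c := 1 / 8) (by norm_num) (y := fun k => next^[k] f)
    (fun k => hg _ (hadm k)) (fun k => (hadm k).1) fun k p => by
      rw [Function.iterate_succ_apply']; exact hmix _ (hadm k) p

end Sufficiency

/-! ### The characterization of implementable functions -/

theorem mainTheorem2 (n : ℕ) (K : Set (Fin n → ℝ)) (hK : IsCompact K)
    (hKcube : K ⊆ Set.Icc (0 : Fin n → ℝ) 1)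
    (f : K → ℝ) (hf : ∀ p : K, f p ∈ Set.Icc (0 : ℝ) 1) :
    ImplementableByFactory K f ↔
      (Continuous f ∧ PolynomiallyBounded K f ∧ PolynomiallyBounded K (fun p => 1 - f p)) := by
  rw [← realizable_iff hf]
  exact ⟨fun h => ⟨h.continuous, h.polynomiallyBounded hKcube,
    (h.compl hKcube).polynomiallyBounded hKcube⟩, fun h => Admissible.realizable hK hKcube ⟨hf, h⟩⟩
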